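/- \textbf{Theorem.} Let $(X,\mu)$ be a Lebesgue space with continuous measure, i.e. a standard Borel space with an atomless probability measure, considered $\operatorname{mod} 0$. A \emph{filtration} of $(X,\mu)$ is a decreasing sequence $\mathfrak A_0\supseteq\mathfrak A_1\supseteq\mathfrak A_2\supseteq\cdots$ of $\sigma$-algebras of measurable sets, where $\mathfrak A_0$ is ($\operatorname{mod} 0$) the $\sigma$-algebra of all measurable sets. It is \emph{locally finite} if for every $n$ almost all conditional measures with respect to $\mathfrak A_n$ are atomic with finitely many atoms, and only finitely many metric types (multisets of masses of the atoms) occur among them. Two filtered probability spaces are \emph{isomorphic} if there is a $\operatorname{mod} 0$ isomorphism of the measure spaces that, for every $n$, carries the $n$th $\sigma$-algebra of one filtration to the $n$th $\sigma$-algebra of the other one ($\operatorname{mod} 0$). Let $\{\mathfrak A_n\}_{n\ge 0}$ be a locally finite (not necessarily ergodic) filtration of a Lebesgue space $(X,\mu)$ with continuous measure. Then: (1) there exists a one-sided (in general time-inhomogeneous) Markov chain $x_0,x_1,x_2,\dots$ with finite state spaces such that $\{\mathfrak A_n\}$ is isomorphic to the tail filtration $\{\sigma(x_n,x_{n+1},\dots)\}_{n\ge0}$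 on the space of trajectories of the chain endowed with its law; (2) equivalently, in terms of graphs, there exist an equipped graded graph $(\Gamma,\Lambda)$ and a Markov measure $\nu$ on its path space $T(\Gamma)$ such that $\{\mathfrak A_n\}$ is isomorphic to the tail filtration of $(T(\Gamma),\nu)$. Here $\Gamma=\coprod_{n\ge0}\Gamma_n$ is an $\mathbb N$-graded graph with finite levels $\Gamma_n$ and simple edges joining vertices of successive levels, $\Gamma_0$ consists of a single initial vertex, every vertex has a successor, and every non-initial vertex has a predecessor; $T(\Gamma)$ is the space of infinite paths from the initial vertex; the equipment $\Lambda=\{\lambda^u_v\}$ assigns to every vertex $v\in\Gamma_{n+1}$ a probability vector with strictly positive components indexed by the predecessors $u\in\Gamma_n$ of $v$; a Markov measure on $(\Gamma,\Lambda)$ is a Borel probability measure $\nu$ on $T(\Gamma)$ for which the sequence of vertices $(v_n)_{n\ge 0}$ of a path is a Markov chain with $\nu(v_n=u,\ v_{n+1}=v)=\lambda^u_v\,\nu(v_{n+1}=v)$ for all edges $(u,v)$; and the $n$th $\sigma$-algebra of the tail filtration of $T(\Gamma)$ consists of the Borel sets that contain, together with a path $(v_k)_{k\ge0}$, every path $(v'_k)_{k\ge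 0}$ with $v'_k=v_k$ for all $k>n$. -/

import Mathlib

open MeasureTheory
open scoped ENNReal NNReal

/-- Two `σ`-algebras agree `mod 0` with respect to `μ`: every set of either of them coincides,
up to a `μ`-null set, with a set of the other one. -/
def EqModZero {X : Type*} [MeasurableSpace X] (μ : Measure X) (𝔄 𝔅 : MeasurableSpace X) : Prop :=
  (∀ A, MeasurableSet[𝔄] A → ∃ B, MeasurableSet[𝔅] B ∧ A =ᵐ[μ] B) ∧
  (∀ B, MeasurableSet[𝔅] B → ∃ A, MeasurableSet[𝔄] A ∧ A =ᵐ[μ] B)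

/-- Decreasing filtrations `𝔄 0 ⊇ 𝔄 1 ⊇ 𝔄 2 ⊇ ⋯` by `σ`-algebras of measurable sets are
filtrations indexed by `ℕᵒᵈ`; this is the `n`-th `σ`-algebra. -/
abbrev level {X : Type*} {m : MeasurableSpace X} (𝔄 : Filtration ℕᵒᵈ m) (n : ℕ) :
    MeasurableSpace X :=
  𝔄 (OrderDual.toDual n)

/-- Isomorphism of two filtered probability spaces: an isomorphism `mod 0` of the measure spaces
that carries, for every `n`, the `n`-th `σ`-algebra of one filtration to the `n`-th `σ`-algebra of
the other one (`mod 0`). -/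
def FiltrationsIsomorphic {X Z : Type*} {mX : MeasurableSpace X} {mZ : MeasurableSpace Z}
    (μ : Measure X) (𝔄 : Filtration ℕᵒᵈ mX) (ν : Measure Z) (𝔅 : Filtration ℕᵒᵈ mZ) : Prop :=
  ∃ (f : X → Z) (g : Z → X), MeasurePreserving f μ ν ∧ MeasurePreserving g ν μ ∧
    (∀ᵐ x ∂μ, g (f x) = x) ∧ (∀ᵐ z ∂ν, f (g z) = z) ∧
    ∀ n, EqModZero μ (level 𝔄 n) ((level 𝔅 n).comap f)

/-- `ν` is a purely atomic measure with finitely many atoms, and `s` is its metric type: the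
multiset of the masses of its atoms. -/
def HasAtomicType {X : Type*} [MeasurableSpace X] (ν : Measure X) (s : Multiset ℝ≥0∞) : Prop :=
  ∃ t : Finset X, (∀ y ∈ t, ν {y} ≠ 0) ∧ ν ((t : Set X)ᶜ) = 0 ∧
    t.val.map (fun y => ν {y}) = s

/-- A locally finite filtration of a standard probability space: the `0`-th `σ`-algebra is (`mod 0`)
the `σ`-algebra of all measurable sets, i.e. it corresponds to the partition into singletons, and,
for every `n`, almost all conditional measures with respect to the `n`-th `σ`-algebra are atomic
with finitely many atoms and have only finitely many metric types. -/
structure IsLocallyFinite {X : Type*} {m : MeasurableSpace X} [StandardBorelSpace X]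
    (μ : Measure X) [IsProbabilityMeasure μ] (𝔄 : Filtration ℕᵒᵈ m) : Prop where
  zero_eq : EqModZero μ (level 𝔄 0) m
  finite_types : ∀ n, ∃ F : Set (Multiset ℝ≥0∞), F.Finite ∧
    ∀ᵐ x ∂μ, ∃ s ∈ F, HasAtomicType (ProbabilityTheory.condExpKernel μ (level 𝔄 n) x) s

/-- The Markov property of a sequence of random variables `x n` with values in finite sets, in
product form:
`Prob (x (n+1) = y (n+1) | x 0 = y 0, …, x n = y n) = Prob (x (n+1) = y (n+1) | x n = y n)`. -/
def HasMarkovProperty {Ω : Type*} [MeasurableSpace Ω] {Y : ℕ → Type} (P : Measure Ω)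
    (x : ∀ n, Ω → Y n) : Prop :=
  ∀ (n : ℕ) (y : ∀ k, Y k),
    P {ω | ∀ k ≤ n + 1, x k ω = y k} * P {ω | x n ω = y n} =
      P {ω | ∀ k ≤ n, x k ω = y k} * P {ω | x n ω = y n ∧ x (n + 1) ω = y (n + 1)}

/-- The space of all sequences `x 0, x 1, x 2, …` with `x n ∈ Y n`. -/
def Trajectories (Y : ℕ → Type) : Type := ∀ n, Y n

/-- The `σ`-algebra on the space of sequences generated by the coordinates. -/
instance (Y : ℕ → Type) : MeasurableSpace (Trajectories Y) :=
  ⨆ n, MeasurableSpace.comap (fun x : Trajectories Y => x n) ⊤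

/-- A one-sided Markov chain `x 0, x 1, x 2, …` (in general inhomogeneous in time) with finite state
spaces, given by its law on the space of trajectories. -/
structure FiniteMarkovChain where
  /-- the state space at time `n` -/
  State : ℕ → Type
  state_finite : ∀ n, Finite (State n)
  /-- the law of the chain -/
  law : Measure (Trajectories State)
  law_prob : IsProbabilityMeasure law
  markov : HasMarkovProperty law (fun n (x : Trajectories State) => x n)

/-- The tail filtration of a Markov chain: its `n`-th `σ`-algebra is generated by
`x n, x (n+1), x (n+2), …`. -/
def FiniteMarkovChain.tail (C : FiniteMarkovChain) :
    Filtration ℕᵒᵈ (inferInstance : MeasurableSpace (Trajectories C.State)) where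
  seq n := ⨆ k, ⨆ _ : OrderDual.ofDual n ≤ k,
    MeasurableSpace.comap (fun x : Trajectories C.State => x k) ⊤
  mono' _ _ hij := iSup_mono fun _ => iSup_mono' fun hk =>
    ⟨le_trans (OrderDual.ofDual_le_ofDual.mpr hij) hk, le_rfl⟩
  le' _ := iSup_le fun k => iSup_le fun _ =>
    le_iSup (fun k => MeasurableSpace.comap (fun x : Trajectories C.State => x k) ⊤) k

/-- A locally finite infinite `ℕ`-graded graph with simple edges (a Bratteli diagram): finite levels
`V 0, V 1, V 2, …`, a unique initial vertex, edges joining vertices of successive levels; every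
vertex has a successor, and every vertex other than the initial one has a predecessor. -/
structure GradedGraph where
  /-- the set of vertices of level `n` -/
  V : ℕ → Type
  fintypeV : ∀ n, Fintype (V n)
  /-- the initial vertex -/
  root : V 0
  root_unique : ∀ v : V 0, v = root
  /-- the edges between the levels `n` and `n + 1` -/
  Edge : ∀ n, V n → V (n + 1) → Prop
  exists_succ : ∀ n (u : V n), ∃ v, Edge n u v
  exists_pred : ∀ n (v : V (n + 1)), ∃ u, Edge n u v

namespace GradedGraph

instance (Γ : GradedGraph) (n : ℕ) : Fintype (Γ.V n) := Γ.fintypeV n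

/-- The space of infinite paths starting at the initial vertex. -/
def Path (Γ : GradedGraph) : Type :=
  {γ : ∀ n, Γ.V n // ∀ n, Γ.Edge n (γ n) (γ (n + 1))}

/-- The vertex of level `n` of a path. -/
def Path.vertex {Γ : GradedGraph} (n : ℕ) (γ : Γ.Path) : Γ.V n := γ.1 n

/-- The Borel `σ`-algebra of the path space; it is generated by the cylinder sets. -/
instance (Γ : GradedGraph) : MeasurableSpace Γ.Path :=
  ⨆ n, MeasurableSpace.comap (fun γ : Γ.Path => γ.vertex n) ⊤

/-- The `n`-th `σ`-algebra of the tail filtration: all measurable sets of paths that do not change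
if the initial segment of a path, up to level `n`, is modified. -/
abbrev tailAlgebra (Γ : GradedGraph) (n : ℕ) : MeasurableSpace Γ.Path where
  MeasurableSet' A := MeasurableSet A ∧
    ∀ γ γ' : Γ.Path, (∀ k, n < k → γ'.vertex k = γ.vertex k) → γ ∈ A → γ' ∈ A
  measurableSet_empty := ⟨MeasurableSet.empty, fun _ _ _ h => h⟩
  measurableSet_compl A hA :=
    ⟨hA.1.compl, fun γ γ' h hγ hγ' => hγ (hA.2 γ' γ (fun k hk => (h k hk).symm) hγ')⟩
  measurableSet_iUnion A hA :=
    ⟨MeasurableSet.iUnion fun i => (hA i).1, fun γ γ' h hγ => by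
      obtain ⟨i, hi⟩ := Set.mem_iUnion.mp hγ
      exact Set.mem_iUnion.mpr ⟨i, (hA i).2 γ γ' h hi⟩⟩

/-- The tail filtration of the path space. -/
def tail (Γ : GradedGraph) : Filtration ℕᵒᵈ (inferInstance : MeasurableSpace Γ.Path) where
  seq n := Γ.tailAlgebra (OrderDual.ofDual n)
  mono' _ _ hij _ hA := ⟨hA.1, fun γ γ' h hγ => hA.2 γ γ'
    (fun k hk => h k (lt_of_le_of_lt (OrderDual.ofDual_le_ofDual.mpr hij) hk)) hγ⟩
  le' _ _ hA := hA.1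

end GradedGraph

/-- An equipped graded graph: to every vertex `v` of level `n + 1` there is assigned a probability
vector `cotrans n · v` (the cotransition probabilities), which lives on the edges coming to `v`. -/
structure EquippedGraph extends GradedGraph where
  /-- the cotransition probability of the edge from `u` to `v` -/
  cotrans : ∀ n, V n → V (n + 1) → ℝ≥0
  cotrans_pos : ∀ n u v, 0 < cotrans n u v ↔ Edge n u v
  cotrans_sum : ∀ n (v : V (n + 1)), ∑ u : toGradedGraph.V n, cotrans n u v = 1

/-- A measure on the path space agrees with the equipment:
`Prob (x n = u | x (n+1) = v) = cotrans n u v`. -/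
def EquippedGraph.Agrees (Γ : EquippedGraph) (ν : Measure Γ.Path) : Prop :=
  ∀ n (u : Γ.V n) (v : Γ.V (n + 1)),
    ν {γ | γ.vertex n = u ∧ γ.vertex (n + 1) = v} =
      Γ.cotrans n u v * ν {γ | γ.vertex (n + 1) = v}

/-- Markov measures on the path space of an equipped graph: probability measures with the Markov
property that have the prescribed cotransition probabilities. -/
structure EquippedGraph.IsMarkovMeasure (Γ : EquippedGraph) (ν : Measure Γ.Path) : Prop where
  prob : IsProbabilityMeasure ν
  markov : HasMarkovProperty ν (fun n (γ : Γ.Path) => γ.vertex n)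
  agrees : Γ.Agrees ν

/-! Write `κ n` for the conditional measures with respect to `𝔄 n`. They have finitely many atoms
and finitely many metric types, so almost surely `κ n x E` takes its values in one finite set,
whatever `E` is, and `κ n x {x} ≠ 0`.

Separation: if a real function `f` generates `𝔄 n` mod `0`, the conditional distribution function `x
↦ κ (n+1) x {f < f x}` is `𝔄 n`-measurable and has essentially finitely many values. Since `x`
carries mass, it distinguishes the values of `f` within a fibre of `𝔄 (n+1)`. Hence `𝔄 n` is
contained in `𝔄 (n+1)` mod `0` on each of its level sets (`exists_fibre_coding`).

Coding: fix sets `C k`, with `C 0` the whole space, such that every `𝔄 n` is generated mod `0` by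
those `C k` that belong to it. Recursively, let the finite-valued, `𝔄 n`-measurable `x n` record
both the separating value and all the numbers `κ n (C k ∩ {past code ∈ Q})`, `k ≤ n`, where the past
is `x 0, …, x (n-1)`.

Markov property: by `k = 0` the conditional law of the past given `𝔄 n` depends on `x n` only, and
`𝔄 n` contains the future.

Generation: let `C k ∈ 𝔄 n`. Once `x n, …, x (n+k-1)` are fixed, `C k` is `𝔄 (n+k)`-measurable mod
`0`, so membership in it is read off from a conditional probability recorded in `x (n+k)`
(`measurableSet_of_isCodingStep`). Thus `x n, x (n+1), …` generate `𝔄 n`.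

Both statements follow by transporting `μ` along `ω ↦ (x n ω)`; for the graph an initial vertex is
prepended and null vertices and edges are removed. -/

open ProbabilityTheory Set

/-! ### Finitely atomic measures and inclusion of `σ`-algebras mod `0` -/

/-- The finite set of all masses that a measure of one of the given metric types can give to
a set. -/
def massValues (F : Set (Multiset ℝ≥0∞)) : Set ℝ≥0∞ :=
  ⋃ s ∈ F, Multiset.sum '' {t | t ≤ s}

theorem finite_massValues {F : Set (Multiset ℝ≥0∞)} (hF : F.Finite) : (massValues F).Finite :=
  hF.biUnion fun s _ => (by
    have : {t | t ≤ s} = {t | t ∈ s.powerset} := by ext; simp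
    rw [this]
    exact (Multiset.finite_toSet s.powerset).image _)

/-- Only the atoms inside `E` contribute, and their masses form a sub-multiset of `s`. No
measurability of `E` is needed. -/
theorem HasAtomicType.measure_mem {X : Type*} [MeasurableSpace X] [MeasurableSingletonClass X]
    {ν : Measure X} {s : Multiset ℝ≥0∞} {F : Set (Multiset ℝ≥0∞)} (h : HasAtomicType ν s)
    (hs : s ∈ F) (E : Set X) : ν E ∈ massValues F := by
  classical
  obtain ⟨t, -, ht, rfl⟩ := h
  refine mem_biUnion hs ⟨(t.filter (· ∈ E)).val.map fun y => ν {y}, ?_, ?_⟩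
  · exact Multiset.map_le_map (by simp)
  · change ∑ y ∈ t.filter (· ∈ E), ν {y} = _
    rw [sum_measure_singleton, ← measure_inter_add_sdiff₀ E t.measurableSet.nullMeasurableSet]
    have : ν (E \ t) = 0 := measure_mono_null (fun x hx => hx.2) ht
    rw [this, add_zero]
    congr 1
    ext x
    simp [and_comm]

theorem HasAtomicType.ae_singleton_ne_zero {X : Type*} [MeasurableSpace X] {ν : Measure X}
    {s : Multiset ℝ≥0∞} (h : HasAtomicType ν s) : ν {y | ν {y} = 0} = 0 := by
  obtain ⟨t, h0, ht, -⟩ := h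
  exact measure_mono_null (fun y (hy : ν {y} = 0) hyt => h0 y hyt hy) ht

/-- Inclusion mod `0` is expressed as `≤` into an `eventuallyMeasurableSpace`. This is itself a
`σ`-algebra, so inclusions can be checked on generators and composed. -/
theorem eqModZero_of_le {X : Type*} {𝔄 𝔅 : MeasurableSpace X} [MeasurableSpace X] {μ : Measure X}
    (h₁ : 𝔄 ≤ eventuallyMeasurableSpace 𝔅 (ae μ))
    (h₂ : 𝔅 ≤ eventuallyMeasurableSpace 𝔄 (ae μ)) : EqModZero μ 𝔄 𝔅 :=
  ⟨h₁, fun B hB => let ⟨A, hA, h⟩ := h₂ B hB; ⟨A, hA, h.symm⟩⟩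

theorem le_eventuallyMeasurableSpace_trans {X : Type*} {l : Filter X} [CountableInterFilter l]
    {m₁ m₂ m₃ : MeasurableSpace X} (h₁ : m₁ ≤ eventuallyMeasurableSpace m₂ l)
    (h₂ : m₂ ≤ eventuallyMeasurableSpace m₃ l) : m₁ ≤ eventuallyMeasurableSpace m₃ l := by
  intro A hA
  obtain ⟨B, hB, hAB⟩ := h₁ A hA
  obtain ⟨C, hC, hBC⟩ := h₂ B hB
  exact ⟨C, hC, hAB.trans hBC⟩

/-! ### Conditional measures with positive mass at the base point -/

section Kernel

variable {X : Type*} {m m' : MeasurableSpace X} [mX : MeasurableSpace X] [StandardBorelSpace X]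
  {μ : Measure X} [IsProbabilityMeasure μ]

/-- A point `x` together with a `κ x`-random point has the law of `(x, x)` when the first coordinate
is observed through `m` only. -/
theorem lintegral_condExpKernel_section (hm : m ≤ mX) {T : Set (X × X)}
    (hT : MeasurableSet[m.prod mX] T) :
    ∫⁻ x, condExpKernel μ m x (Prod.mk x ⁻¹' T) ∂μ = μ {x | (x, x) ∈ T} := by
  have h := congrArg (fun ρ => ρ T) (compProd_trim_condExpKernel (μ := μ) hm)
  have hd : @Measurable X (X × X) mX (m.prod mX) Function.diag :=
    @Measurable.prodMk X mX X X m mX id id (measurable_id'' hm) measurable_id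
  rw [@Measure.map_apply _ _ mX (m.prod mX) _ _ hd _ hT,
    @Measure.compProd_apply X X m mX _ _ _ _ _ hT, lintegral_trim hm] at h
  · exact h
  · exact @Kernel.measurable_kernel_prodMk_left X X m mX _ _ _ hT

theorem setLIntegral_condExpKernel (hm : m ≤ mX) {B E : Set X} (hB : MeasurableSet[m] B)
    (hE : MeasurableSet E) : ∫⁻ x in B, condExpKernel μ m x E ∂μ = μ (B ∩ E) := by
  classical
  have hT : MeasurableSet[m.prod mX] (B ×ˢ E) := @MeasurableSet.prod _ _ m mX _ _ hB hE
  have := lintegral_condExpKernel_section (μ := μ) hm hT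
  rw [← lintegral_indicator (hm _ hB)]
  refine Eq.trans (lintegral_congr fun x => ?_) this
  by_cases hx : x ∈ B <;> simp [hx]

/-- Each conditional measure gives no mass to its set of non-atoms; integrating this over `x` and
evaluating on the diagonal gives the claim. -/
theorem ae_condExpKernel_singleton_ne_zero (hm : m ≤ mX)
    (h : ∀ᵐ x ∂μ, ∃ s, HasAtomicType (condExpKernel μ m x) s) :
    ∀ᵐ x ∂μ, condExpKernel μ m x {x} ≠ 0 := by
  have hT : MeasurableSet[m.prod mX] {p : X × X | condExpKernel μ m p.1 {p.2} = 0} := by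
    let κ : @Kernel (X × X) X (m.prod mX) mX :=
      @Kernel.comap X X m mX (X × X) (m.prod mX) (condExpKernel μ m) Prod.fst
        (@measurable_fst X X m mX)
    have hκ : @IsMarkovKernel _ _ (m.prod mX) mX κ := by
      let _ : MeasurableSpace (X × X) := m.prod mX
      exact Kernel.IsMarkovKernel.comap _ _
    let _ : MeasurableSpace (X × X) := m.prod mX
    -- The mass of a moving point is the mass of a section of this set, hence jointly measurable.
    have hS : MeasurableSet {q : (X × X) × X | q.2 = q.1.2} :=
      measurableSet_eq_fun measurable_snd ((@measurable_snd X X m mX).comp measurable_fst)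
    have := Kernel.measurable_kernel_prodMk_left (κ := κ) hS
    exact this (measurableSet_singleton 0)
  have := lintegral_condExpKernel_section (μ := μ) hm hT
  rw [lintegral_eq_zero_of_ae_eq_zero] at this
  · rw [ae_iff]
    simpa using this.symm
  · filter_upwards [h] with x ⟨s, hs⟩
    exact hs.ae_singleton_ne_zero

/-- Measurability is with respect to `m'` only: the kernel is constant on the fibres of `m`, but the
threshold `f x` varies there. -/
theorem measurable_condExpKernel_Iio (hm : m ≤ m') (hm' : m' ≤ mX)
    {f : X → ℝ} (hf : Measurable[m'] f) :
    Measurable[m'] fun x => condExpKernel μ m x {y | f y < f x} := by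
  let _ : MeasurableSpace (X × ℝ) := m'.prod (borel ℝ)
  let κ : @Kernel (X × ℝ) X (m'.prod (borel ℝ)) mX :=
    @Kernel.comap X X m mX (X × ℝ) (m'.prod (borel ℝ)) (condExpKernel μ m) Prod.fst
      ((@measurable_fst X ℝ m' (borel ℝ)).mono le_rfl hm)
  have hκ : IsMarkovKernel κ := Kernel.IsMarkovKernel.comap _ _
  have hS : MeasurableSet {q : (X × ℝ) × X | f q.2 < q.1.2} :=
    measurableSet_lt ((hf.mono hm' le_rfl).comp measurable_snd)
      ((@measurable_snd X ℝ m' (borel ℝ)).comp measurable_fst)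
  have := Kernel.measurable_kernel_prodMk_left (κ := κ) hS
  exact this.comp (@Measurable.prodMk X m' X ℝ m' (borel ℝ) id f measurable_id hf)


theorem ae_condExpKernel_inter_eq_zero (hm : m ≤ mX) {D E : Set X} (hD : MeasurableSet[m] D)
    (hE : MeasurableSet E) : ∀ᵐ x ∂μ, x ∉ D → condExpKernel μ m x (D ∩ E) = 0 := by
  have h := setLIntegral_condExpKernel (μ := μ) hm hD.compl ((hm _ hD).inter hE)
  rw [← inter_assoc, compl_inter_self, empty_inter, measure_empty,
    lintegral_eq_zero_iff ((measurable_condExpKernel ((hm _ hD).inter hE)).mono hm le_rfl)] at h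
  exact (ae_restrict_iff' (hm _ hD.compl)).1 h

theorem condExpKernel_congr (hm : m ≤ mX) {E E' : Set X} (hE : MeasurableSet E)
    (hE' : MeasurableSet E') (h : E =ᵐ[μ] E') :
    ∀ᵐ x ∂μ, condExpKernel μ m x E = condExpKernel μ m x E' := by
  have key : ∀ {E E' : Set X}, MeasurableSet E → MeasurableSet E' → E =ᵐ[μ] E' →
      ∀ᵐ x ∂μ, condExpKernel μ m x (E \ E') = 0 := by
    intro E E' hE hE' h
    have h' := setLIntegral_condExpKernel (μ := μ) hm MeasurableSet.univ (hE.diff hE')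
    rw [univ_inter, ae_le_set.1 h.le, Measure.restrict_univ,
      lintegral_eq_zero_iff ((measurable_condExpKernel (hE.diff hE')).mono hm le_rfl)] at h'
    exact h'
  filter_upwards [key hE hE' h, key hE' hE h.symm] with x h₁ h₂
  exact measure_congr (Filter.EventuallyLE.antisymm (ae_le_set.2 h₁) (ae_le_set.2 h₂))

/-- A set that is measurable mod `0` with respect to `m` on the event `s`, is recovered there
from the conditional probability of its part in `s`. -/
theorem ae_mem_iff_condExpKernel_ne_zero (hm : m ≤ mX)
    (h : ∀ᵐ x ∂μ, condExpKernel μ m x {x} ≠ 0) {A s : Set X} (hA : MeasurableSet A)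
    (hs : MeasurableSet s)
    (hAs : MeasurableSet[eventuallyMeasurableSpace m (ae (μ.restrict s))] A) :
    ∀ᵐ x ∂μ, x ∈ s → (x ∈ A ↔ condExpKernel μ m x (A ∩ s) ≠ 0) := by
  obtain ⟨D, hD, hAD⟩ := hAs
  have hAD' : (A ∩ s : Set X) =ᵐ[μ] (D ∩ s : Set X) := by
    have := (ae_restrict_iff' hs).1 hAD
    filter_upwards [this] with x hx
    by_cases hxs : x ∈ s
    · have := hx hxs
      change (x ∈ A) = (x ∈ D) at this
      change (x ∈ A ∧ x ∈ s) = (x ∈ D ∧ x ∈ s)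
      rw [this]
    · change (x ∈ A ∧ x ∈ s) = (x ∈ D ∧ x ∈ s)
      simp [hxs]
  filter_upwards [h, hAD'.mem_iff, ae_condExpKernel_inter_eq_zero hm hD hs,
    condExpKernel_congr hm (hA.inter hs) ((hm _ hD).inter hs) hAD'] with x h₁ h₂ h₃ h₄ hxs
  -- A point of `A ∩ s` contributes its own positive mass; at a point outside `D` the conditional
  -- measure of `D ∩ s` vanishes.
  constructor
  · intro hxA h0
    have hsub : {x} ⊆ A ∩ s := singleton_subset_iff.2 ⟨hxA, hxs⟩
    exact h₁ (measure_mono_null hsub h0)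
  · intro h0
    by_contra hxA
    rw [h₄] at h0
    have h₂' : x ∈ A ∩ s ↔ x ∈ D ∩ s := h₂
    exact h0 (h₃ fun hxD => hxA (h₂'.2 ⟨hxD, hxs⟩).1)

/-- A `σ`-algebra whose conditional measures are atomic is generated mod `0` by a real function. -/
theorem exists_measurable_real_generating (hm : m ≤ mX)
    (h : ∀ᵐ x ∂μ, condExpKernel μ m x {x} ≠ 0) :
    ∃ f : X → ℝ, Measurable[m] f ∧
      m ≤ eventuallyMeasurableSpace ((borel ℝ).comap f) (ae μ) := by
  obtain ⟨C, hCc, hCg, hCp⟩ : ∃ C : Set (Set X), C.Countable ∧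
      mX = MeasurableSpace.generateFrom C ∧ IsPiSystem C :=
    ⟨generateSetAlgebra (MeasurableSpace.countableGeneratingSet X),
      countable_generateSetAlgebra MeasurableSpace.countable_countableGeneratingSet,
      by rw [generateFrom_generateSetAlgebra_eq,
        MeasurableSpace.generateFrom_countableGeneratingSet],
      fun _ hs _ ht _ => isSetAlgebra_generateSetAlgebra.inter_mem hs ht⟩
  have : Countable C := hCc
  let F : X → C → ℝ≥0∞ := fun x c => condExpKernel μ m x c
  have hCm : ∀ c : C, MeasurableSet (c : Set X) := fun c => by
    rw [hCg]; exact MeasurableSpace.measurableSet_generateFrom c.2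
  have hF : Measurable[m] F := by
    refine @measurable_pi_lambda _ _ _ m _ _ fun c => measurable_condExpKernel (hCm c)
  -- A Borel code of the values of the kernel on a countable π-system, which determine the whole
  -- conditional measure.
  let f : X → ℝ := embeddingReal _ ∘ F
  have he := measurableEmbedding_embeddingReal (C → ℝ≥0∞)
  have hf : Measurable[m] f := he.measurable.comp hF
  refine ⟨f, hf, fun A hA => ?_⟩
  have hFf : Measurable[(borel ℝ).comap f] F := by
    intro s hs
    refine ⟨embeddingReal _ '' s, he.measurableSet_image' hs, ?_⟩
    rw [preimage_comp, preimage_image_eq _ he.injective]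
  have hκ : Measurable[(borel ℝ).comap f] fun x => condExpKernel μ m x := by
    have hprob : ∀ x, IsProbabilityMeasure (condExpKernel μ m x) := fun x =>
      IsMarkovKernel.isProbabilityMeasure x
    let _ : MeasurableSpace X := mX
    refine @Measurable.measure_of_isPiSystem_of_isProbabilityMeasure X X ((borel ℝ).comap f) mX _
      hprob C hCg hCp fun s hs => ?_
    exact (measurable_pi_apply (⟨s, hs⟩ : C)).comp hFf
  have hκA := Measure.measurable_coe (hm _ hA)
  refine ⟨{x | condExpKernel μ m x A ≠ 0}, (hκA.comp hκ) (measurableSet_singleton 0).compl, ?_⟩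
  filter_upwards [ae_mem_iff_condExpKernel_ne_zero hm h (hm _ hA) MeasurableSet.univ
    (le_eventuallyMeasurableSpace _ hA)] with x hx
  have := hx trivial
  rw [inter_univ] at this
  exact propext this

/-- On a set where the conditional distribution function of `f` is constant, the `σ`-algebra
generated by `f` is contained mod `0` in the `σ`-algebra on which one conditions. -/
theorem comap_le_of_condExpKernel_Iio_eq
    (h : ∀ᵐ x ∂μ, condExpKernel μ m x {x} ≠ 0) {f : X → ℝ} (hf : Measurable f) {s : Set X}
    (hs : MeasurableSet s) {c : ℝ≥0∞}
    (hc : ∀ᵐ x ∂μ, x ∈ s → condExpKernel μ m x {y | f y < f x} = c) :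
    (borel ℝ).comap f ≤ eventuallyMeasurableSpace m (ae (μ.restrict s)) := by
  refine Measurable.comap_le (m₁ := eventuallyMeasurableSpace m (ae (μ.restrict s))) ?_
  refine measurable_of_Ioi (mδ := eventuallyMeasurableSpace m (ae (μ.restrict s))) fun q => ?_
  -- The distribution function of `f` jumps at `f x` because `x` has positive mass. So `q < f x`
  -- holds exactly when the mass of `{f ≤ q}` does not exceed the mass `c` of `{f < f x}`.
  refine ⟨{x | condExpKernel μ m x {y | f y ≤ q} ≤ c},
    measurable_condExpKernel (hf measurableSet_Iic) measurableSet_Iic, ?_⟩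
  refine (ae_restrict_iff' hs).2 ?_
  filter_upwards [h, hc] with x hx hxc hxs
  refine propext ?_
  change q < f x ↔ condExpKernel μ m x {y | f y ≤ q} ≤ c
  rw [← hxc hxs]
  constructor
  · exact fun hq => measure_mono fun y (hy : f y ≤ q) => hy.trans_lt hq
  · intro hle
    by_contra! hq
    refine (lt_of_lt_of_le ?_ hle).ne rfl
    calc condExpKernel μ m x {y | f y < f x}
        < condExpKernel μ m x {y | f y < f x} + condExpKernel μ m x {x} :=
          ENNReal.lt_add_right (measure_ne_top _ _) hx
      _ = condExpKernel μ m x ({y | f y < f x} ∪ {x}) :=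
          (measure_union (by simp) (measurableSet_singleton x)).symm
      _ ≤ _ := measure_mono (by
          rintro y (hy | rfl)
          · exact (le_of_lt hy).trans hq
          · exact hq)

end Kernel

/-! ### Finite codes and their concatenation -/

/-- Finitely many functions with finitely many values factor through one function with finitely
many values. -/
theorem exists_common_code {X ι : Type*} {m : MeasurableSpace X} [Finite ι] {g : ι → X → ℝ≥0∞}
    (hg : ∀ i, Measurable[m] (g i)) (hfin : ∀ i, (range (g i)).Finite) :
    ∃ z : X → ℕ, Measurable[m] z ∧ (range z).Finite ∧ ∀ i, ∃ c : ℕ → ℝ≥0∞, g i = c ∘ z := by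
  let G : X → ι → ℝ≥0∞ := fun x i => g i x
  have hG : (range G).Finite := (Finite.pi' hfin).subset (by
    rintro _ ⟨x, rfl⟩ i
    exact mem_range_self x)
  have hGm : Measurable[m] G := @measurable_pi_lambda _ _ _ m _ _ hg
  have : Finite (range G) := hG
  obtain ⟨e, he⟩ := Countable.exists_injective_nat (range G)
  refine ⟨fun x => e ⟨G x, mem_range_self x⟩, ?_, ?_, fun i => ?_⟩
  · exact (measurable_of_countable e).comp
      (hGm.subtype_mk (h := fun x => mem_range_self x))
  · refine (finite_range e).subset ?_
    rintro _ ⟨x, rfl⟩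
    exact mem_range_self _
  · refine ⟨Function.extend e (fun y => y.1 i) 0, ?_⟩
    ext x
    simp [he.extend_apply, G]

/-- Almost all conditional measures with respect to `m` are atomic with finitely many atoms, and
they have only finitely many metric types. -/
def HasFiniteTypes {X : Type*} (m : MeasurableSpace X) [MeasurableSpace X] [StandardBorelSpace X]
    (μ : Measure X) [IsProbabilityMeasure μ] : Prop :=
  ∃ F : Set (Multiset ℝ≥0∞), F.Finite ∧
    ∀ᵐ x ∂μ, ∃ s ∈ F, HasAtomicType (condExpKernel μ m x) s

theorem measurable_indicator_id {S : Set ℝ≥0∞} (hS : S.Finite) : Measurable (S.indicator id) :=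
  measurable_id.indicator hS.measurableSet

theorem finite_range_indicator_id {X : Type*} {S : Set ℝ≥0∞} (hS : S.Finite) (g : X → ℝ≥0∞) :
    (range fun x => S.indicator id (g x)).Finite := by
  refine (hS.insert 0).subset ?_
  rintro _ ⟨x, rfl⟩
  by_cases h : g x ∈ S
  · simp [h]
  · simp [h]

/-- The code of the values `x n, …, x (n + j - 1)`. -/
def segmentCode {X : Type*} (x : ℕ → X → ℕ) (n : ℕ) : ℕ → X → ℕ
  | 0 => fun _ => 0
  | j + 1 => fun ω => Nat.pair (x (n + j) ω) (segmentCode x n j ω)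

theorem exists_segmentCode_eq_comp {X : Type*} (x : ℕ → X → ℕ) (n j : ℕ) :
    ∃ φ : ℕ → ℕ, segmentCode x n j = φ ∘ segmentCode x 0 (n + j) := by
  induction j with
  | zero => exact ⟨fun _ => 0, rfl⟩
  | succ j ih =>
    obtain ⟨φ, hφ⟩ := ih
    refine ⟨fun t => Nat.pair t.unpair.1 (φ t.unpair.2), ?_⟩
    ext ω
    simp [← add_assoc, segmentCode, hφ]

theorem exists_preimage_segmentCode {X : Type*} (x : ℕ → X → ℕ) (y : ℕ → ℕ) (n : ℕ) :
    ∃ τ : ℕ, {ω | ∀ k < n, x k ω = y k} = segmentCode x 0 n ⁻¹' {τ} := by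
  induction n with
  | zero => exact ⟨0, by ext; simp [segmentCode]⟩
  | succ n ih =>
    obtain ⟨τ, hτ⟩ := ih
    refine ⟨Nat.pair (y n) τ, ?_⟩
    ext ω
    have : (∀ k < n, x k ω = y k) ↔ segmentCode x 0 n ω = τ := Set.ext_iff.1 hτ ω
    change (∀ k < n + 1, x k ω = y k) ↔ Nat.pair (x (0 + n) ω) (segmentCode x 0 n ω) = _
    rw [Nat.pair_eq_pair, ← this, zero_add, Nat.forall_lt_succ_right, and_comm]

theorem measurable_segmentCode {X : Type*} {m : MeasurableSpace X} {x : ℕ → X → ℕ} {n : ℕ}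
    (hx : ∀ k, n ≤ k → Measurable (x k)) (j : ℕ) : Measurable (segmentCode x n j) := by
  induction j with
  | zero => exact measurable_const
  | succ j ih =>
    exact (measurable_of_countable fun p : ℕ × ℕ => Nat.pair p.1 p.2).comp
      ((hx _ (Nat.le_add_right n j)).prodMk ih)

/-- Fixing the segment fixes each `x (n + i)`, `i < j`, so the `j` one-step inclusions compose. -/
theorem le_eventuallyMeasurableSpace_segmentCode {X : Type*} [MeasurableSpace X] {μ : Measure X}
    {𝔄 : ℕ → MeasurableSpace X}
    {x : ℕ → X → ℕ}
    (hsep : ∀ n l, 𝔄 n ≤ eventuallyMeasurableSpace (𝔄 (n + 1)) (ae (μ.restrict (x n ⁻¹' {l}))))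
    (n j i : ℕ) :
    𝔄 n ≤ eventuallyMeasurableSpace (𝔄 (n + j))
      (ae (μ.restrict (segmentCode x n j ⁻¹' {i}))) := by
  induction j generalizing i with
  | zero => exact le_eventuallyMeasurableSpace
  | succ j ih =>
    have hsub₁ : segmentCode x n (j + 1) ⁻¹' {i} ⊆ segmentCode x n j ⁻¹' {i.unpair.2} := by
      rintro ω rfl
      simp [segmentCode]
    have hsub₂ : segmentCode x n (j + 1) ⁻¹' {i} ⊆ x (n + j) ⁻¹' {i.unpair.1} := by
      rintro ω rfl
      simp [segmentCode]
    refine le_eventuallyMeasurableSpace_trans (m₂ := 𝔄 (n + j)) ?_ ?_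
    · intro A hA
      obtain ⟨B, hB, hAB⟩ := ih i.unpair.2 A hA
      exact ⟨B, hB, ae_restrict_of_ae_restrict_of_subset hsub₁ hAB⟩
    · intro A hA
      obtain ⟨B, hB, hAB⟩ := hsep (n + j) i.unpair.1 A hA
      exact ⟨B, hB, ae_restrict_of_ae_restrict_of_subset hsub₂ hAB⟩

/-! ### The coding sequence and its Markov property -/

section Coding

variable {X : Type*} {m m' : MeasurableSpace X} [mX : MeasurableSpace X] [StandardBorelSpace X]
  {μ : Measure X} [IsProbabilityMeasure μ]

theorem HasFiniteTypes.ae_singleton_ne_zero (h : HasFiniteTypes m μ) (hm : m ≤ mX) :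
    ∀ᵐ x ∂μ, condExpKernel μ m x {x} ≠ 0 := by
  obtain ⟨F, -, h⟩ := h
  exact ae_condExpKernel_singleton_ne_zero hm (h.mono fun x ⟨s, _, hs⟩ => ⟨s, hs⟩)

theorem HasFiniteTypes.exists_finite (h : HasFiniteTypes m μ) :
    ∃ S : Set ℝ≥0∞, S.Finite ∧ ∀ᵐ x ∂μ, ∀ E : Set X, condExpKernel μ m x E ∈ S := by
  obtain ⟨F, hF, h⟩ := h
  exact ⟨massValues F, finite_massValues hF, h.mono fun x ⟨s, hs, hx⟩ E => hx.measure_mem hs E⟩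

/-- For a pair of successive `σ`-algebras of a locally finite filtration there is a function with
finitely many values that encodes given conditional probabilities and separates the points of
almost all fibres. -/
theorem exists_fibre_coding (hmm : m ≤ m') (hm' : m' ≤ mX) (h : HasFiniteTypes m μ)
    (h' : HasFiniteTypes m' μ) {ι : Type*} [Finite ι] {E : ι → Set X}
    (hE : ∀ i, MeasurableSet (E i)) :
    ∃ z : X → ℕ, Measurable[m'] z ∧ (range z).Finite ∧
      (∀ i, ∃ c : ℕ → ℝ≥0∞, ∀ᵐ x ∂μ, condExpKernel μ m' x (E i) = c (z x)) ∧
      ∀ l, m' ≤ eventuallyMeasurableSpace m (ae (μ.restrict (z ⁻¹' {l}))) := by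
  obtain ⟨f, hf, hfm⟩ := exists_measurable_real_generating hm' (h'.ae_singleton_ne_zero hm')
  obtain ⟨S, hS, hSm⟩ := h.exists_finite
  obtain ⟨S', hS', hSm'⟩ := h'.exists_finite
  -- Cutting off values outside the finite sets changes these functions on a null set only and makes
  -- their ranges finite everywhere.
  let g : Option ι → X → ℝ≥0∞ := fun o => match o with
    | none => fun x => S.indicator id (condExpKernel μ m x {y | f y < f x})
    | some i => fun x => S'.indicator id (condExpKernel μ m' x (E i))
  obtain ⟨z, hz, hzf, hzc⟩ := exists_common_code (m := m') (g := g)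
    (by
      rintro (_ | i)
      · exact (measurable_indicator_id hS).comp (measurable_condExpKernel_Iio hmm hm' hf)
      · exact (measurable_indicator_id hS').comp (measurable_condExpKernel (hE i)))
    (by
      rintro (_ | i)
      · exact finite_range_indicator_id hS _
      · exact finite_range_indicator_id hS' _)
  refine ⟨z, hz, hzf, fun i => ?_, fun l => ?_⟩
  · obtain ⟨c, hc⟩ := hzc (some i)
    refine ⟨c, ?_⟩
    filter_upwards [hSm'] with x hx
    have := congrFun hc x
    simpa [g, hx (E i)] using this
  · obtain ⟨c, hc⟩ := hzc none
    have hle := comap_le_of_condExpKernel_Iio_eq (h.ae_singleton_ne_zero (hmm.trans hm'))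
      (hf.mono hm' le_rfl) ((hz.mono hm' le_rfl) (measurableSet_singleton l)) (c := c l) (by
        filter_upwards [hSm] with x hx hxl
        have := congrFun hc x
        have hxl : z x = l := hxl
        simpa [g, hx _, hxl] using this)
    refine le_eventuallyMeasurableSpace_trans (fun A hA => ?_) hle
    obtain ⟨B, hB, hAB⟩ := hfm A hA
    exact ⟨B, hB, ae_restrict_of_ae hAB⟩

/-- The `σ`-algebras `𝔄 n` are generated mod `0` by sets of one sequence. -/
theorem exists_generating_sequence {𝔄 : ℕ → MeasurableSpace X} (hle : ∀ n, 𝔄 n ≤ mX)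
    (h : ∀ n, HasFiniteTypes (𝔄 n) μ) :
    ∃ C : ℕ → Set X, C 0 = univ ∧ (∀ k, MeasurableSet (C k)) ∧
      ∀ n, 𝔄 n ≤ eventuallyMeasurableSpace
        (MeasurableSpace.generateFrom {A | MeasurableSet[𝔄 n] A ∧ A ∈ range C}) (ae μ) := by
  choose f hf hfg using fun n =>
    exists_measurable_real_generating (hle n) ((h n).ae_singleton_ne_zero (hle n))
  obtain ⟨s, hs⟩ := exists_surjective_nat (ℕ × ℚ)
  let D : ℕ × ℚ → Set X := fun p => f p.1 ⁻¹' Ioi (p.2 : ℝ)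
  have hD : ∀ p, MeasurableSet[𝔄 p.1] (D p) := fun p => hf p.1 measurableSet_Ioi
  -- Index `0` is reserved for the whole space, which later yields the Markov property.
  refine ⟨fun k => Nat.casesOn k univ fun j => D (s j), rfl, ?_, fun n => ?_⟩
  · rintro (_ | k)
    · exact MeasurableSet.univ
    · exact hle _ _ (hD (s k))
  · refine le_eventuallyMeasurableSpace_trans (hfg n) (le_trans ?_ le_eventuallyMeasurableSpace)
    rw [Real.borel_eq_generateFrom_Ioi_rat, MeasurableSpace.comap_generateFrom]
    refine MeasurableSpace.generateFrom_mono ?_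
    rintro _ ⟨A, hA, rfl⟩
    obtain ⟨q, rfl⟩ := mem_iUnion.1 hA
    obtain ⟨k, hk⟩ := hs (n, q)
    refine ⟨hD (n, q), k + 1, ?_⟩
    simp [hk, D]

/-- The `n`-th function of a coding sequence encodes the conditional distribution with respect to
`𝔄 n` of the code of its past, also jointly with the sets `C k`, `k ≤ n`, and separates the points
of almost all fibres. -/
structure IsCodingStep (μ : Measure X) [IsProbabilityMeasure μ] (𝔄 : ℕ → MeasurableSpace X)
    (C : ℕ → Set X) (n : ℕ) (T z : X → ℕ) : Prop where
  measurable : Measurable[𝔄 n] z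
  finite_range : (range z).Finite
  exists_eq : ∀ k ≤ n, ∀ Q : Set ℕ, ∃ c : ℕ → ℝ≥0∞,
    ∀ᵐ x ∂μ, condExpKernel μ (𝔄 n) x (C k ∩ T ⁻¹' Q) = c (z x)
  separates : ∀ l, 𝔄 n ≤ eventuallyMeasurableSpace (𝔄 (n + 1)) (ae (μ.restrict (z ⁻¹' {l})))

theorem exists_isCodingStep {𝔄 : ℕ → MeasurableSpace X} (hanti : Antitone 𝔄)
    (hle : ∀ n, 𝔄 n ≤ mX) (h : ∀ n, HasFiniteTypes (𝔄 n) μ) {C : ℕ → Set X}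
    (hC : ∀ k, MeasurableSet (C k)) (n : ℕ) {T : X → ℕ} (hT : Measurable T)
    (hTf : (range T).Finite) : ∃ z, IsCodingStep μ 𝔄 C n T z := by
  have : Finite (range T) := hTf
  obtain ⟨z, hz, hzf, hzc, hzs⟩ := exists_fibre_coding (μ := μ) (hanti (Nat.le_succ n)) (hle n)
    (h (n + 1)) (h n) (ι := Fin (n + 1) × Set (range T))
    (E := fun p => C p.1 ∩ T ⁻¹' (Subtype.val '' p.2))
    (fun p => (hC _).inter (hT (MeasurableSet.of_discrete)))
  refine ⟨z, hz, hzf, fun k hk Q => ?_, hzs⟩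
  obtain ⟨c, hc⟩ := hzc (⟨k, Nat.lt_succ_of_le hk⟩, {t | t.1 ∈ Q})
  have : T ⁻¹' (Subtype.val '' {t : range T | t.1 ∈ Q}) = T ⁻¹' Q := by
    ext x
    simp
  simp only [this] at hc
  exact ⟨c, hc⟩

theorem exists_coding_sequence {𝔄 : ℕ → MeasurableSpace X} (hanti : Antitone 𝔄)
    (hle : ∀ n, 𝔄 n ≤ mX) (h : ∀ n, HasFiniteTypes (𝔄 n) μ) {C : ℕ → Set X}
    (hC : ∀ k, MeasurableSet (C k)) :
    ∃ x : ℕ → X → ℕ, ∀ n, IsCodingStep μ 𝔄 C n (segmentCode x 0 n) (x n) := by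
  -- The recursion runs over codes of the past, since the choice of `x n` depends on all earlier
  -- functions.
  let 𝒯 := {T : X → ℕ // Measurable T ∧ (range T).Finite}
  choose z hz using fun (n : ℕ) (T : 𝒯) => exists_isCodingStep hanti hle h hC n T.2.1 T.2.2
  let next : ℕ → 𝒯 → 𝒯 := fun n T => ⟨fun ω => Nat.pair (z n T ω) (T.1 ω),
    (measurable_of_countable fun p : ℕ × ℕ => Nat.pair p.1 p.2).comp
      (((hz n T).measurable.mono (hle n) le_rfl).prodMk T.2.1),
    (((hz n T).finite_range.prod T.2.2).image fun p => Nat.pair p.1 p.2).subset (by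
      rintro _ ⟨ω, rfl⟩
      exact ⟨(_, _), ⟨mem_range_self ω, mem_range_self ω⟩, rfl⟩)⟩
  let T : ℕ → 𝒯 := fun n => Nat.rec ⟨fun _ => 0, measurable_const,
    (finite_singleton 0).subset (by rintro _ ⟨_, rfl⟩; rfl)⟩ next n
  have hT : ∀ n, segmentCode (fun n => z n (T n)) 0 n = (T n).1 := by
    intro n
    induction n with
    | zero => rfl
    | succ n ih =>
      ext ω
      simp only [segmentCode, ih, zero_add]
      rfl
  refine ⟨fun n => z n (T n), fun n => ?_⟩
  rw [hT]
  exact hz n (T n)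

/-- Waiting until time `n + k` ensures that `C k` is among the sets recorded there, and the
intermediate values `U` make `C k` measurable mod `0` with respect to `𝔄 (n + k)`. -/
theorem measurableSet_of_isCodingStep {𝔄 : ℕ → MeasurableSpace X} (hle : ∀ n, 𝔄 n ≤ mX)
    (h : ∀ n, HasFiniteTypes (𝔄 n) μ) {C : ℕ → Set X} (hC : ∀ k, MeasurableSet (C k))
    {x : ℕ → X → ℕ} (hx : ∀ n, IsCodingStep μ 𝔄 C n (segmentCode x 0 n) (x n)) {n k : ℕ}
    (hxt : ∀ k, n ≤ k → Measurable[m] (x k)) (hCk : MeasurableSet[𝔄 n] (C k)) :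
    MeasurableSet[eventuallyMeasurableSpace m (ae μ)] (C k) := by
  have hxm : ∀ n, Measurable (x n) := fun n => (hx n).measurable.mono (hle n) le_rfl
  let U := segmentCode x n k
  have hUm : Measurable[mX] U := measurable_segmentCode (m := mX) (fun k _ => hxm k) k
  have hUt : Measurable[m] U := measurable_segmentCode (m := m) hxt k
  have hc : ∀ i, ∃ c : ℕ → ℝ≥0∞,
      ∀ᵐ ω ∂μ, condExpKernel μ (𝔄 (n + k)) ω (C k ∩ U ⁻¹' {i}) = c (x (n + k) ω) := by
    intro i
    obtain ⟨φ, hφ⟩ := exists_segmentCode_eq_comp x n k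
    have := (hx (n + k)).exists_eq k (Nat.le_add_left k n) (φ ⁻¹' {i})
    rwa [← preimage_comp, ← hφ] at this
  choose c hc using hc
  have hxU := (hxt (n + k) (Nat.le_add_right n k)).prodMk hUt
  -- On `{U = i}` membership in `C k` means that the conditional probability of `C k ∩ {U = i}` is
  -- nonzero.
  refine ⟨{ω | c (U ω) (x (n + k) ω) ≠ 0},
    hxU (MeasurableSet.of_discrete (s := {p : ℕ × ℕ | c p.2 p.1 ≠ 0})), ?_⟩
  have hmem := ae_all_iff.2 fun i => ae_mem_iff_condExpKernel_ne_zero (hle (n + k))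
    ((h (n + k)).ae_singleton_ne_zero (hle _)) (hC k) (hUm (measurableSet_singleton i))
    (le_eventuallyMeasurableSpace_segmentCode (fun n => (hx n).separates) n k i _ hCk)
  filter_upwards [hmem, ae_all_iff.2 hc] with ω h₁ h₂
  refine propext ?_
  change ω ∈ C k ↔ c (U ω) (x (n + k) ω) ≠ 0
  rw [← h₂ (U ω)]
  exact h₁ (U ω) rfl

/-- The sequence of functions that encodes a locally finite filtration. -/
theorem exists_markov_coding {𝔄 : ℕ → MeasurableSpace X} (hanti : Antitone 𝔄)
    (hle : ∀ n, 𝔄 n ≤ mX) (h : ∀ n, HasFiniteTypes (𝔄 n) μ) :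
    ∃ x : ℕ → X → ℕ, (∀ n, Measurable[𝔄 n] (x n)) ∧ (∀ n, (range (x n)).Finite) ∧
      (∀ n, 𝔄 n ≤ eventuallyMeasurableSpace
        (⨆ k, ⨆ _ : n ≤ k, MeasurableSpace.comap (x k) ⊤) (ae μ)) ∧
      HasMarkovProperty (Y := fun _ => ℕ) μ x := by
  obtain ⟨C, hC0, hC, hCg⟩ := exists_generating_sequence hle h
  obtain ⟨x, hx⟩ := exists_coding_sequence hanti hle h hC
  have hxm : ∀ n, Measurable (x n) := fun n => (hx n).measurable.mono (hle n) le_rfl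
  refine ⟨x, fun n => (hx n).measurable, fun n => (hx n).finite_range, fun n => ?_, ?_⟩
  · refine le_eventuallyMeasurableSpace_trans (hCg n) (MeasurableSpace.generateFrom_le ?_)
    rintro _ ⟨hCk, k, rfl⟩
    exact measurableSet_of_isCodingStep hle h hC hx (fun k hk =>
      Measurable.of_comap_le (le_iSup₂_of_le k hk le_rfl)) hCk
  · intro n y
    obtain ⟨τ, hτ⟩ := exists_preimage_segmentCode x y n
    obtain ⟨c, hc⟩ := (hx n).exists_eq 0 (Nat.zero_le n) {τ}
    rw [hC0, univ_inter, ← hτ] at hc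
    set E : Set X := {ω | ∀ k < n, x k ω = y k} with hE
    have hEm : MeasurableSet E := by
      rw [hτ]
      exact measurable_segmentCode (fun k _ => hxm k) n (measurableSet_singleton τ)
    -- Given `x n = y n`, the strict past `E` is independent of all of `𝔄 n`; both sides of the
    -- Markov identity are instances.
    have key : ∀ B : Set X, MeasurableSet[𝔄 n] B → B ⊆ x n ⁻¹' {y n} →
        μ (B ∩ E) = c (y n) * μ B := by
      intro B hB hsub
      rw [← setLIntegral_condExpKernel (hle n) hB hEm, ← setLIntegral_const]
      refine setLIntegral_congr_fun_ae (hle n _ hB) ?_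
      filter_upwards [hc] with ω hω hωB
      rw [hω, show x n ω = y n from hsub hωB]
    have hB₀ := (hx n).measurable (measurableSet_singleton (y n))
    have hB₁ := hanti (Nat.le_succ n) _
      ((hx (n + 1)).measurable (measurableSet_singleton (y (n + 1))))
    have e₁ : {ω | ∀ k ≤ n, x k ω = y k} = {ω | x n ω = y n} ∩ E := by
      ext ω
      simp only [hE, ← Nat.lt_succ_iff, mem_ofPred_eq, mem_inter_iff, Nat.succ_eq_add_one,
        Nat.forall_lt_succ_right]
      exact and_comm
    have e₂ : {ω | ∀ k ≤ n + 1, x k ω = y k} =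
        {ω | x n ω = y n ∧ x (n + 1) ω = y (n + 1)} ∩ E := by
      ext ω
      simp only [hE, ← Nat.lt_succ_iff, mem_ofPred_eq, mem_inter_iff, Nat.succ_eq_add_one,
        Nat.forall_lt_succ_right]
      tauto
    rw [e₁, e₂, key {ω | x n ω = y n} hB₀ subset_rfl,
      key {ω | x n ω = y n ∧ x (n + 1) ω = y (n + 1)} (@MeasurableSet.inter _ (𝔄 n) _ _ hB₀ hB₁)
        fun ω hω => hω.1]
    ring

end Coding

/-! ### Transport to a space of sequences -/

section Transport

variable {X Z : Type*} [mX : MeasurableSpace X] [mZ : MeasurableSpace Z] {μ : Measure X}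
  {V : ℕ → Type} {p : ∀ n, Z → V n}

theorem measurableSet_preimage_of_eq_iSup (hmZ : mZ = ⨆ n, MeasurableSpace.comap (p n) ⊤) (n : ℕ)
    (s : Set (V n)) : MeasurableSet (p n ⁻¹' s) := by
  rw [hmZ]
  exact le_iSup (fun n => MeasurableSpace.comap (p n) ⊤) n _ ⟨s, trivial, rfl⟩

theorem measurable_of_eq_iSup (hmZ : mZ = ⨆ n, MeasurableSpace.comap (p n) ⊤) {f : X → Z}
    (hf : ∀ n (s : Set (V n)), MeasurableSet (f ⁻¹' (p n ⁻¹' s))) : Measurable f := by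
  subst hmZ
  refine Measurable.of_comap_le ?_
  rw [MeasurableSpace.comap_iSup]
  refine iSup_le fun n => ?_
  rw [MeasurableSpace.comap_comp]
  rintro _ ⟨s, -, rfl⟩
  exact hf n s

/-- Equality of points is equality of countably many coordinates with countably many values. This
lets an almost sure identity pass to the image measure. -/
theorem measurableSet_fixedPoints [∀ n, Countable (V n)]
    (hmZ : mZ = ⨆ n, MeasurableSpace.comap (p n) ⊤)
    (hp : ∀ z z', (∀ n, p n z = p n z') → z = z') {φ : Z → Z} (hφ : Measurable φ) :
    MeasurableSet {z | φ z = z} := by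
  have : {z | φ z = z} = ⋂ n, ⋃ u, φ ⁻¹' (p n ⁻¹' {u}) ∩ p n ⁻¹' {u} := by
    ext z
    simp only [mem_ofPred_eq, mem_iInter, mem_iUnion, mem_inter_iff, mem_preimage,
      mem_singleton_iff]
    refine ⟨fun h n => ⟨p n z, by rw [h], rfl⟩, fun h => hp _ _ fun n => ?_⟩
    obtain ⟨u, h₁, h₂⟩ := h n
    rw [h₁, h₂]
  rw [this]
  exact .iInter fun n => .iUnion fun u =>
    (hφ (measurableSet_preimage_of_eq_iSup hmZ n _)).inter (measurableSet_preimage_of_eq_iSup hmZ n _)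

/-- A map that carries one filtration to another one mod `0` is an isomorphism of filtered spaces
onto its image measure if the first filtration starts with the `σ`-algebra of all measurable
sets. -/
theorem filtrationsIsomorphic_map [StandardBorelSpace X] [IsProbabilityMeasure μ]
    [∀ n, Countable (V n)] (hmZ : mZ = ⨆ n, MeasurableSpace.comap (p n) ⊤)
    (hp : ∀ z z', (∀ n, p n z = p n z') → z = z') {f : X → Z} (hf : Measurable f)
    {𝔄 : Filtration ℕᵒᵈ mX} {𝔅 : Filtration ℕᵒᵈ mZ} (h0 : EqModZero μ (level 𝔄 0) mX)
    (h : ∀ n, EqModZero μ (level 𝔄 n) ((level 𝔅 n).comap f)) :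
    FiltrationsIsomorphic μ 𝔄 (μ.map f) 𝔅 := by
  have : Nonempty X := μ.nonempty_of_neZero
  have hgen : ∀ A, MeasurableSet A → ∃ B, MeasurableSet B ∧ A =ᵐ[μ] f ⁻¹' B := by
    intro A hA
    obtain ⟨A', hA', hAA'⟩ := h0.2 A hA
    obtain ⟨_, ⟨B, hB, rfl⟩, hA'B⟩ := (h 0).1 A' hA'
    exact ⟨B, 𝔅.le _ _ hB, hAA'.symm.trans hA'B⟩
  obtain ⟨e, he, hinj⟩ := MeasurableSpace.measurable_injection_nat_bool_of_countablySeparated X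
  have hemb : MeasurableEmbedding e := he.measurableEmbedding hinj
  -- Each binary digit of an injective code of `X` is, mod `0`, a function of `f x`; decoding these
  -- digits gives the inverse map.
  choose B hB heB using fun k : ℕ =>
    hgen _ (((measurable_pi_apply k).comp he) (measurableSet_singleton true))
  classical
  let ψ : Z → ℕ → Bool := fun z k => decide (z ∈ B k)
  have hψ : Measurable ψ := measurable_pi_lambda _ fun k => measurable_to_bool (by
    convert hB k
    ext z
    simp [ψ])
  let g : Z → X := hemb.invFun ∘ ψ
  have hg : Measurable g := hemb.measurable_invFun.comp hψ
  have hgf : ∀ᵐ x ∂μ, g (f x) = x := by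
    filter_upwards [ae_all_iff.2 heB] with x hx
    have : ψ (f x) = e x := by
      ext k
      have hk : (e x k = true) = (f x ∈ B k) := hx k
      simp [ψ, ← hk]
    simp only [g, Function.comp_apply, this]
    exact hemb.leftInverse_invFun x
  refine ⟨f, g, ⟨hf, rfl⟩, ⟨hg, ?_⟩, hgf, ?_, h⟩
  · rw [Measure.map_map hg hf]
    exact (Measure.map_congr hgf).trans Measure.map_id
  · refine (ae_map_iff hf.aemeasurable (measurableSet_fixedPoints hmZ hp (hf.comp hg))).2 ?_
    exact hgf.mono fun x hx => congrArg f hx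

theorem HasMarkovProperty.map (hmZ : mZ = ⨆ n, MeasurableSpace.comap (p n) ⊤) {f : X → Z}
    (hf : Measurable f) (h : HasMarkovProperty μ fun n => p n ∘ f) :
    HasMarkovProperty (μ.map f) p := by
  have hm := measurableSet_preimage_of_eq_iSup hmZ
  intro n y
  have h₁ : ∀ N, MeasurableSet {z | ∀ k ≤ N, p k z = y k} := fun N => by
    have : {z | ∀ k ≤ N, p k z = y k} = ⋂ k, ⋂ _ : k ≤ N, p k ⁻¹' {y k} := by ext; simp
    rw [this]
    exact .iInter fun k => .iInter fun _ => hm k _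
  rw [Measure.map_apply hf (h₁ _), Measure.map_apply hf (h₁ _),
    Measure.map_apply hf (show MeasurableSet {z | p n z = y n} from hm n {y n}),
    Measure.map_apply hf (show MeasurableSet {z | p n z = y n ∧ p (n + 1) z = y (n + 1)} from
      (hm n {y n}).inter (hm (n + 1) {y (n + 1)}))]
  exact h n y

end Transport

/-! ### Realization by a Markov chain -/

section Chain

variable {X : Type*} [mX : MeasurableSpace X] [StandardBorelSpace X] {μ : Measure X}
  [IsProbabilityMeasure μ]

theorem exists_finiteMarkovChain {𝔄 : Filtration ℕᵒᵈ mX} (h0 : EqModZero μ (level 𝔄 0) mX)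
    {x : ℕ → X → ℕ} (hx : ∀ n, Measurable[level 𝔄 n] (x n)) (hfin : ∀ n, (range (x n)).Finite)
    (hgen : ∀ n, level 𝔄 n ≤ eventuallyMeasurableSpace
      (⨆ k, ⨆ _ : n ≤ k, MeasurableSpace.comap (x k) ⊤) (ae μ))
    (hmar : HasMarkovProperty (Y := fun _ => ℕ) μ x) :
    ∃ C : FiniteMarkovChain, FiltrationsIsomorphic μ 𝔄 C.law C.tail := by
  have hanti : ∀ {n k : ℕ}, n ≤ k → level 𝔄 k ≤ level 𝔄 n := fun h =>
    𝔄.mono (OrderDual.toDual_le_toDual.2 h)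
  let State : ℕ → Type := fun n => range (x n)
  have hS : ∀ n, Finite (State n) := hfin
  let f : X → Trajectories State := fun ω n => ⟨x n ω, mem_range_self ω⟩
  let p : ∀ n, Trajectories State → State n := fun n z => z n
  have hpre : ∀ n (s : Set (range (x n))),
      x n ⁻¹' (Subtype.val '' s) = {ω | ⟨x n ω, mem_range_self ω⟩ ∈ s} := fun n s => by
    ext ω
    simp
  have hf : Measurable f := measurable_of_eq_iSup (p := p) rfl fun n s => by
    have := 𝔄.le _ _ ((hx n) (MeasurableSet.of_discrete (s := Subtype.val '' s)))
    rw [hpre] at this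
    exact this
  have hmf : HasMarkovProperty μ fun n => p n ∘ f := by
    intro n y
    have := hmar n fun k => (y k).1
    have hiff : ∀ k ω, x k ω = (y k).1 ↔ (p k ∘ f) ω = y k := fun k ω =>
      (Subtype.ext_iff (a1 := ⟨x k ω, mem_range_self ω⟩) (a2 := y k)).symm
    simp only [hiff] at this
    exact this
  let C : FiniteMarkovChain :=
    { State := State
      state_finite := hS
      law := μ.map f
      law_prob := Measure.isProbabilityMeasure_map hf.aemeasurable
      markov := hmf.map rfl hf }
  have hcomap : ∀ n, (level C.tail n).comap f =
      ⨆ k, ⨆ _ : n ≤ k, MeasurableSpace.comap (x k) ⊤ := by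
    intro n
    change (⨆ k, ⨆ _ : n ≤ k, MeasurableSpace.comap (p k) ⊤).comap f = _
    simp only [MeasurableSpace.comap_iSup, MeasurableSpace.comap_comp]
    refine iSup_congr fun k => iSup_congr fun _ => le_antisymm ?_ ?_
    · rintro _ ⟨s, -, rfl⟩
      exact ⟨Subtype.val '' s, trivial, hpre k s⟩
    · rintro _ ⟨s, -, rfl⟩
      exact ⟨Subtype.val ⁻¹' s, trivial, rfl⟩
  refine ⟨C, filtrationsIsomorphic_map (p := p) rfl (fun z z' h => funext h) hf h0 fun n => ?_⟩
  rw [hcomap]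
  refine eqModZero_of_le (hgen n) (le_trans ?_ le_eventuallyMeasurableSpace)
  exact iSup₂_le fun k hk => ((hx k).comap_le).trans (hanti hk)

end Chain

/-! ### Realization by an equipped graded graph -/

section Graph

theorem GradedGraph.nonempty_vertex (Γ : GradedGraph) (n : ℕ) : Nonempty (Γ.V n) := by
  induction n with
  | zero => exact ⟨Γ.root⟩
  | succ n ih => exact ⟨(Γ.exists_succ n ih.some).choose⟩

theorem GradedGraph.exists_segment_to (Γ : GradedGraph) (n : ℕ) (v : Γ.V n) :
    ∃ q : ∀ k, Γ.V k, q n = v ∧ ∀ k < n, Γ.Edge k (q k) (q (k + 1)) := by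
  classical
  induction n with
  | zero =>
    exact ⟨Function.update (fun k => (Γ.nonempty_vertex k).some) 0 v, by simp, by simp⟩
  | succ n ih =>
    obtain ⟨u, hu⟩ := Γ.exists_pred n v
    obtain ⟨q, hq, hqe⟩ := ih u
    refine ⟨Function.update q (n + 1) v, by simp, fun k hk => ?_⟩
    rcases Nat.lt_succ_iff_lt_or_eq.1 hk with h | rfl
    · rw [Function.update_of_ne (by lia), Function.update_of_ne (by lia)]
      exact hqe k h
    · rw [Function.update_of_ne (by lia), Function.update_self, hq]
      exact hu

/-- The initial segment of paths, up to level `n`, can be replaced by one that depends only on the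
vertex of level `n + 1`. -/
theorem GradedGraph.exists_canonical_segment (Γ : GradedGraph) (n : ℕ) :
    ∃ ρ : Γ.Path → Γ.Path, (∀ γ k, n < k → (ρ γ).vertex k = γ.vertex k) ∧
      ∀ k (s : Set (Γ.V k)), ∃ j, n < j ∧ ∃ t : Set (Γ.V j),
        {γ | (ρ γ).vertex k ∈ s} = {γ | γ.vertex j ∈ t} := by
  choose q hq hqe using Γ.exists_segment_to (n + 1)
  let ρ : Γ.Path → Γ.Path := fun γ =>
    ⟨fun k => if n < k then γ.1 k else q (γ.1 (n + 1)) k, fun k => by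
      rcases lt_trichotomy n k with h | rfl | h
      · simpa [h, h.trans (Nat.lt_succ_self k)] using γ.2 k
      · have := hqe (γ.1 (n + 1)) n (Nat.lt_succ_self n)
        rw [hq] at this
        simpa using this
      · have := hqe (γ.1 (n + 1)) k (by lia)
        simpa [not_lt.2 h.le, not_lt.2 (Nat.succ_le_of_lt h)] using this⟩
  have h₁ : ∀ γ k, n < k → (ρ γ).vertex k = γ.vertex k := fun γ k hk => if_pos hk
  have h₂ : ∀ γ k, ¬ n < k → (ρ γ).vertex k = q (γ.vertex (n + 1)) k := fun γ k hk => if_neg hk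
  refine ⟨ρ, h₁, fun k s => ?_⟩
  by_cases hk : n < k
  · exact ⟨k, hk, s, by simp only [h₁ _ k hk]⟩
  · exact ⟨n + 1, Nat.lt_succ_self n, {v | q v k ∈ s}, by simp only [h₂ _ k hk]; rfl⟩

/-- The `n`-th `σ`-algebra of the tail filtration of a graph is generated by the vertices of the
levels above `n`. -/
theorem GradedGraph.tailAlgebra_eq (Γ : GradedGraph) (n : ℕ) :
    Γ.tailAlgebra n = ⨆ k, ⨆ _ : n < k,
      MeasurableSpace.comap (fun γ : Γ.Path => γ.vertex k) ⊤ := by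
  apply le_antisymm
  · obtain ⟨ρ, hρ, hρs⟩ := Γ.exists_canonical_segment n
    have hle : MeasurableSpace.comap ρ
        (⨆ k, MeasurableSpace.comap (fun γ : Γ.Path => γ.vertex k) ⊤) ≤
        ⨆ k, ⨆ _ : n < k, MeasurableSpace.comap (fun γ : Γ.Path => γ.vertex k) ⊤ := by
      rw [MeasurableSpace.comap_iSup]
      refine iSup_le fun k => ?_
      rw [MeasurableSpace.comap_comp]
      rintro _ ⟨s, -, rfl⟩
      obtain ⟨j, hj, t, h⟩ := hρs k s
      exact (le_iSup₂_of_le (f := fun k (_ : n < k) =>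
        MeasurableSpace.comap (fun γ : Γ.Path => γ.vertex k) ⊤) j hj le_rfl) _ ⟨t, trivial, h.symm⟩
    rintro A ⟨hA, hinv⟩
    -- Tail invariance gives `A = ρ ⁻¹' A`, because `γ` and `ρ γ` agree above level `n`.
    refine hle A ⟨A, hA, ?_⟩
    ext γ
    exact ⟨hinv (ρ γ) γ fun k hk => (hρ γ k hk).symm, hinv γ (ρ γ) fun k hk => hρ γ k hk⟩
  · refine iSup₂_le fun k hk => ?_
    rintro _ ⟨s, -, rfl⟩
    refine ⟨measurableSet_preimage_of_eq_iSup (p := fun k (γ : Γ.Path) => γ.vertex k) rfl k s,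
      fun γ γ' h hγ => ?_⟩
    change γ'.vertex k ∈ s
    rw [h k hk]
    exact hγ

variable {X : Type*} [mX : MeasurableSpace X] {V : ℕ → Type}

theorem coe_toNNReal_measure_div_mul {μ : Measure X} [IsFiniteMeasure μ] {B : Set X} (hB : μ B ≠ 0)
    (A : Set X) : ((μ A / μ B).toNNReal : ℝ≥0∞) * μ B = μ A := by
  rw [ENNReal.coe_toNNReal (ENNReal.div_lt_top (measure_ne_top _ _) hB).ne,
    ENNReal.div_mul_cancel hB (measure_ne_top _ _)]

/-- The equipped graph of a sequence of random variables with finitely many values: edges join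
the successive states that occur together with positive probability, and the cotransition
probabilities are the conditional probabilities. -/
noncomputable def equippedGraphOf (μ : Measure X) [IsProbabilityMeasure μ] [∀ n, Fintype (V n)]
    (x : ∀ n, X → V n) (hx : ∀ n s, MeasurableSet (x n ⁻¹' s)) (root : V 0)
    (hroot : ∀ v, v = root) (hpos : ∀ n u, μ (x n ⁻¹' {u}) ≠ 0) : EquippedGraph where
  V := V
  fintypeV := inferInstance
  root := root
  root_unique := hroot
  Edge n u v := μ (x n ⁻¹' {u} ∩ x (n + 1) ⁻¹' {v}) ≠ 0
  exists_succ n u := by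
    by_contra! h
    refine hpos n u (measure_mono_null (fun ω hω => ?_) (measure_iUnion_null h))
    exact mem_iUnion.2 ⟨x (n + 1) ω, hω, rfl⟩
  exists_pred n v := by
    by_contra! h
    refine hpos (n + 1) v (measure_mono_null (fun ω hω => ?_) (measure_iUnion_null h))
    exact mem_iUnion.2 ⟨x n ω, rfl, hω⟩
  cotrans n u v := (μ (x n ⁻¹' {u} ∩ x (n + 1) ⁻¹' {v}) / μ (x (n + 1) ⁻¹' {v})).toNNReal
  cotrans_pos n u v := by
    rw [ENNReal.toNNReal_pos_iff, ENNReal.div_pos_iff]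
    exact ⟨fun h => h.1.1, fun h => ⟨⟨h, measure_ne_top _ _⟩,
      ENNReal.div_lt_top (measure_ne_top _ _) (hpos _ _)⟩⟩
  cotrans_sum n v := by
    rw [← ENNReal.toNNReal_sum fun u _ => (ENNReal.div_lt_top (measure_ne_top _ _) (hpos _ _)).ne]
    simp only [div_eq_mul_inv]
    rw [← Finset.sum_mul]
    let _ : ∀ n, MeasurableSpace (V n) := fun _ => ⊤
    have := sum_measure_preimage_singleton (μ := μ.restrict (x (n + 1) ⁻¹' {v})) Finset.univ
      (f := x n) fun y _ => hx n {y}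
    simp only [Finset.coe_univ, preimage_univ, Measure.restrict_apply MeasurableSet.univ,
      univ_inter, Measure.restrict_apply (hx n _)] at this
    rw [this, ENNReal.mul_inv_cancel (hpos _ _) (measure_ne_top _ _), ENNReal.toNNReal_one]

theorem exists_isMarkovMeasure [StandardBorelSpace X] {μ : Measure X} [IsProbabilityMeasure μ]
    {𝔄 : Filtration ℕᵒᵈ mX} (h0 : EqModZero μ (level 𝔄 0) mX) [∀ n, Fintype (V n)]
    {x : ∀ n, X → V n} (hx : ∀ n s, MeasurableSet (x n ⁻¹' s)) (hV : Subsingleton (V 0))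
    (hpos : ∀ n u, μ (x n ⁻¹' {u}) ≠ 0)
    (hedge : ∀ ω n, μ (x n ⁻¹' {x n ω} ∩ x (n + 1) ⁻¹' {x (n + 1) ω}) ≠ 0)
    (hle : ∀ n k, n < k →
      MeasurableSpace.comap (x k) ⊤ ≤ eventuallyMeasurableSpace (level 𝔄 n) (ae μ))
    (hgen : ∀ n, level 𝔄 n ≤ eventuallyMeasurableSpace
      (⨆ k, ⨆ _ : n < k, MeasurableSpace.comap (x k) ⊤) (ae μ))
    (hmar : HasMarkovProperty μ x) :
    ∃ (Γ : EquippedGraph) (ν : Measure Γ.Path),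
      Γ.IsMarkovMeasure ν ∧ FiltrationsIsomorphic μ 𝔄 ν Γ.tail := by
  have : Nonempty X := μ.nonempty_of_neZero
  let Γ : EquippedGraph := equippedGraphOf μ x hx (x 0 (Classical.arbitrary X))
    (fun v => Subsingleton.elim _ _) hpos
  let f : X → Γ.Path := fun ω => ⟨fun n => x n ω, hedge ω⟩
  let p : ∀ n, Γ.Path → V n := fun n γ => γ.vertex n
  have hf : Measurable f := measurable_of_eq_iSup (p := p) rfl hx
  have hcomap : ∀ n, (level Γ.tail n).comap f =
      ⨆ k, ⨆ _ : n < k, MeasurableSpace.comap (x k) ⊤ := by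
    intro n
    change (Γ.tailAlgebra n).comap f = _
    rw [GradedGraph.tailAlgebra_eq]
    simp only [MeasurableSpace.comap_iSup, MeasurableSpace.comap_comp]
    rfl
  refine ⟨Γ, μ.map f, ⟨Measure.isProbabilityMeasure_map hf.aemeasurable, ?_, ?_⟩,
    filtrationsIsomorphic_map (p := p) rfl (fun z z' h => Subtype.ext (funext h)) hf h0
      fun n => ?_⟩
  · exact HasMarkovProperty.map (p := p) rfl hf hmar
  · intro n u v
    have hm := measurableSet_preimage_of_eq_iSup (p := p) rfl
    rw [Measure.map_apply hf (show MeasurableSet {γ : Γ.Path | γ.vertex (n + 1) = v} from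
        hm (n + 1) {v}),
      Measure.map_apply hf (show MeasurableSet {γ : Γ.Path | γ.vertex n = u ∧ γ.vertex (n + 1) = v}
        from (hm n {u}).inter (hm (n + 1) {v}))]
    exact (coe_toNNReal_measure_div_mul (hpos (n + 1) v) _).symm
  · rw [hcomap]
    exact eqModZero_of_le (hgen n) (iSup₂_le fun k hk => hle n k hk)

theorem ae_measure_preimage_singleton_ne_zero {ι : Type*} [Countable ι] (μ : Measure X)
    (w : X → ι) : ∀ᵐ ω ∂μ, μ (w ⁻¹' {w ω}) ≠ 0 := by
  rw [ae_iff]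
  have : μ (⋃ i ∈ {i | μ (w ⁻¹' {i}) = 0}, w ⁻¹' {i}) = 0 :=
    (measure_biUnion_null_iff (to_countable _)).2 fun i hi => hi
  refine measure_mono_null (fun ω hω => ?_) this
  have hω' : μ (w ⁻¹' {w ω}) = 0 := not_not.1 hω
  exact mem_biUnion hω' rfl

/-- Prepending a constant to a sequence with the Markov property. -/
theorem HasMarkovProperty.cons {μ : Measure X} {x : ℕ → X → ℕ}
    (h : HasMarkovProperty (Y := fun _ => ℕ) μ x) :
    HasMarkovProperty (Y := fun _ => ℕ) μ fun n => Nat.casesOn n (fun _ => 0) x := by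
  -- At time `0` the two sides have the same factors in opposite order. Later, both sides vanish
  -- unless `y 0 = 0`, and then the identity is that of `x` one step earlier.
  rintro (_ | n) y
  · rw [mul_comm]
    congr 2
    · ext ω
      simp
    · ext ω
      simp [Nat.le_one_iff_eq_zero_or_eq_one]
  · by_cases hy : y 0 = 0
    · have hiff : ∀ N, {ω | ∀ k ≤ N + 1, (Nat.casesOn k (fun _ => 0) x : X → ℕ) ω = y k} =
          {ω | ∀ k ≤ N, x k ω = y (k + 1)} := fun N => by
        ext ω
        refine ⟨fun h k hk => h (k + 1) (by lia), ?_⟩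
        rintro h (_ | k) hk
        · exact hy.symm
        · exact h k (by lia)
      rw [hiff, hiff]
      exact h n fun k => y (k + 1)
    · have hem : ∀ N, {ω | ∀ k ≤ N, (Nat.casesOn k (fun _ => 0) x : X → ℕ) ω = y k} = ∅ :=
        fun N => eq_empty_of_forall_notMem fun ω h => hy (h 0 (Nat.zero_le N)).symm
      rw [hem, hem]
      simp

/-- The vertex of level `n + 1` is the state `x n`: the `n`-th tail algebra forgets the levels up to
`n`, so it is generated by `x n, x (n+1), …`. -/
theorem exists_equippedGraph [StandardBorelSpace X] {μ : Measure X} [IsProbabilityMeasure μ]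
    {𝔄 : Filtration ℕᵒᵈ mX} (h0 : EqModZero μ (level 𝔄 0) mX)
    {x : ℕ → X → ℕ} (hx : ∀ n, Measurable[level 𝔄 n] (x n)) (hfin : ∀ n, (range (x n)).Finite)
    (hgen : ∀ n, level 𝔄 n ≤ eventuallyMeasurableSpace
      (⨆ k, ⨆ _ : n ≤ k, MeasurableSpace.comap (x k) ⊤) (ae μ))
    (hmar : HasMarkovProperty (Y := fun _ => ℕ) μ x) :
    ∃ (Γ : EquippedGraph) (ν : Measure Γ.Path),
      Γ.IsMarkovMeasure ν ∧ FiltrationsIsomorphic μ 𝔄 ν Γ.tail := by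
  have hanti : ∀ {n k : ℕ}, n ≤ k → level 𝔄 k ≤ level 𝔄 n := fun h =>
    𝔄.mono (OrderDual.toDual_le_toDual.2 h)
  let v : ℕ → X → ℕ := fun n => Nat.casesOn n (fun _ => 0) x
  have hvm : ∀ n, Measurable (v n) := by
    rintro (_ | n)
    · exact measurable_const
    · exact (hx n).mono (𝔄.le _) le_rfl
  have hvf : ∀ n, (range (v n)).Finite := by
    rintro (_ | n)
    · exact (finite_singleton 0).subset (by rintro _ ⟨_, rfl⟩; rfl)
    · exact hfin n
  let G : Set X := {ω | ∀ n, μ (v n ⁻¹' {v n ω} ∩ v (n + 1) ⁻¹' {v (n + 1) ω}) ≠ 0}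
  have hGae : ∀ᵐ ω ∂μ, ω ∈ G := by
    refine ae_all_iff.2 fun n => ?_
    filter_upwards [ae_measure_preimage_singleton_ne_zero μ fun ω => (v n ω, v (n + 1) ω)] with ω h
    convert h using 2
    ext ω'
    simp
  have hGm : MeasurableSet G := by
    have : G = ⋂ n, (fun ω => (v n ω, v (n + 1) ω)) ⁻¹'
        {q | μ (v n ⁻¹' {q.1} ∩ v (n + 1) ⁻¹' {q.2}) ≠ 0} := by
      ext
      simp [G]
    rw [this]
    exact .iInter fun n => ((hvm n).prodMk (hvm (n + 1))) MeasurableSet.of_discrete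
  obtain ⟨ω₀, hω₀⟩ := hGae.exists
  classical
  -- Points whose trajectory uses a null edge form a null set; moving them to `ω₀` makes every
  -- trajectory a path of the graph.
  let r : X → X := fun ω => if ω ∈ G then ω else ω₀
  have hrG : ∀ ω, r ω ∈ G := fun ω => by
    by_cases h : ω ∈ G <;> simp [r, h, hω₀]
  have hrm : Measurable r := Measurable.ite hGm measurable_id measurable_const
  have hr : ∀ᵐ ω ∂μ, r ω = ω := hGae.mono fun ω h => by simp [r, h]
  have hvpos : ∀ n ω, μ (v n ⁻¹' {v n (r ω)}) ≠ 0 := fun n ω h =>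
    hrG ω n (measure_mono_null inter_subset_left h)
  let V : ℕ → Type := fun n => {i : ℕ // μ (v n ⁻¹' {i}) ≠ 0}
  have hVf : ∀ n, Finite (V n) := fun n => ((hvf n).subset fun i hi => by
    obtain ⟨ω, hω⟩ := nonempty_of_measure_ne_zero hi
    exact ⟨ω, hω⟩ : {i : ℕ | μ (v n ⁻¹' {i}) ≠ 0}.Finite)
  let _ : ∀ n, Fintype (V n) := fun n => Fintype.ofFinite _
  let w : ∀ n, X → V n := fun n ω => ⟨v n (r ω), hvpos n ω⟩
  have hwpre : ∀ n (s : Set (V n)), w n ⁻¹' s = r ⁻¹' (v n ⁻¹' (Subtype.val '' s)) := by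
    intro n s
    ext ω
    refine ⟨fun h => ⟨_, h, rfl⟩, ?_⟩
    rintro ⟨u, hu, h⟩
    have : w n ω = u := Subtype.ext h.symm
    change w n ω ∈ s
    rwa [this]
  have hwae : ∀ n (s : Set (V n)), w n ⁻¹' s =ᵐ[μ] (v n ⁻¹' (Subtype.val '' s) : Set X) := by
    intro n s
    rw [hwpre]
    filter_upwards [hr] with ω hω
    change (v n (r ω) ∈ Subtype.val '' s) = (v n ω ∈ Subtype.val '' s)
    rw [hω]
  have hwiff : ∀ᵐ ω ∂μ, ∀ n (u : V n), w n ω = u ↔ v n ω = u := by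
    filter_upwards [hr] with ω hω n u
    rw [Subtype.ext_iff]
    change v n (r ω) = u ↔ _
    rw [hω]
  have hsing : ∀ n (u : V n), v n ⁻¹' (Subtype.val '' {u}) = v n ⁻¹' {u.1} := by
    intro n u
    rw [image_singleton]
  refine exists_isMarkovMeasure h0 (x := w) (fun n s => ?_) ⟨fun a b => ?_⟩ (fun n u => ?_)
    (fun ω n => ?_) (fun n k hk => ?_) (fun n => ?_) ?_
  · rw [hwpre]
    exact hrm ((hvm n) MeasurableSet.of_discrete)
  · have h : ∀ a : V 0, a.1 = 0 := fun a => by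
      obtain ⟨ω, hω⟩ := nonempty_of_measure_ne_zero a.2
      exact (show (0 : ℕ) = a.1 from hω).symm
    exact Subtype.ext ((h a).trans (h b).symm)
  · rw [measure_congr (hwae n {u}), hsing]
    exact u.2
  · rw [measure_congr ((hwae n {w n ω}).inter (hwae (n + 1) {w (n + 1) ω})), hsing n,
      hsing (n + 1)]
    exact hrG ω n
  · obtain ⟨k, rfl⟩ : ∃ j, k = j + 1 := ⟨k - 1, by lia⟩
    rintro _ ⟨s, -, rfl⟩
    exact ⟨_, hanti (Nat.lt_succ_iff.1 hk) _ ((hx k) MeasurableSet.of_discrete), hwae (k + 1) s⟩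
  · refine le_eventuallyMeasurableSpace_trans (hgen n) (iSup₂_le fun k hk => ?_)
    rintro _ ⟨s, -, rfl⟩
    refine ⟨w (k + 1) ⁻¹' (Subtype.val ⁻¹' s), ?_, ?_⟩
    · exact (le_iSup₂_of_le (f := fun k (_ : n < k) => MeasurableSpace.comap (w k) ⊤) (k + 1)
        (Nat.lt_succ_of_le hk) le_rfl) _ ⟨_, trivial, rfl⟩
    · filter_upwards [hr] with ω hω
      change (v (k + 1) ω ∈ s) = (v (k + 1) (r ω) ∈ s)
      rw [hω]
  · intro n y
    have := hmar.cons n fun k => (y k).1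
    convert this using 2 <;> refine measure_congr ?_
    all_goals
      filter_upwards [hwiff] with ω hω
      refine propext ?_
    · exact forall₂_congr fun k _ => hω k (y k)
    · exact hω n (y n)
    · exact forall₂_congr fun k _ => hω k (y k)
    · exact and_congr (hω n (y n)) (hω (n + 1) (y (n + 1)))

end Graph

theorem theorem5 {X : Type*} [mX : MeasurableSpace X] [StandardBorelSpace X]
    (μ : Measure X) [IsProbabilityMeasure μ] [NullSingletonClass μ]
    (𝔄 : Filtration ℕᵒᵈ mX) (h𝔄 : IsLocallyFinite μ 𝔄) :
    (∃ C : FiniteMarkovChain, FiltrationsIsomorphic μ 𝔄 C.law C.tail) ∧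
    (∃ (Γ : EquippedGraph) (ν : Measure Γ.Path),
      Γ.IsMarkovMeasure ν ∧ FiltrationsIsomorphic μ 𝔄 ν Γ.tail) := by
  obtain ⟨x, hx, hfin, hgen, hmar⟩ := exists_markov_coding (μ := μ) (𝔄 := fun n => level 𝔄 n)
    (fun _ _ h => 𝔄.mono (OrderDual.toDual_le_toDual.2 h)) (fun n => 𝔄.le _) h𝔄.finite_types
  exact ⟨exists_finiteMarkovChain h𝔄.zero_eq hx hfin hgen hmar,
    exists_equippedGraph h𝔄.zero_eq hx hfin hgen hmar⟩
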